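/- Let $\phi_{\mathrm{thr}}(t)=\mathbf 1_{\{t>0\}}$ be the threshold and $\phi_{\mathrm{ReLU}}(t)=\max(0,t)$ the ReLU activation function. For an activation $\phi$, a map $\Phi:\mathbb R^p\to\mathbb R^q$ is called pseudolinear with activation $\phi$ if $\Phi(x)=\phi(Vx-b)$ for some real $q\times p$ matrix $V$ and some $b\in\mathbb R^q$, where $\phi$ is applied to each coordinate. For activations $\phi_1,\phi_2,\phi_3\in\{\phi_{\mathrm{thr}},\phi_{\mathrm{ReLU}}\}$ and positive integers $n,m,d,r$, let $\mathcal F_{\phi_1,\phi_2,\phi_3}(n,m,d,r)$ be the class of all compositions $\Phi_3\circ\Phi_2\circ\Phi_1$ of pseudolinear maps $\Phi_1:\mathbb R^n\to\mathbb R^m$, $\Phi_2:\mathbb R^m\to\mathbb R^d$, $\Phi_3:\mathbb R^d\to\mathbb R^r$ with activations $\phi_1,\phi_2,\phi_3$, respectively. Theorem 6.1. There are absolute constants $C,c>0$ such that the following holds for all $\phi_1,\phi_2,\phi_3\in\{\phi_{\mathrm{thr}},\phi_{\mathrm{ReLU}}\}$, all positive integers $n,m,d,r$ and all integers $K,K_1\ge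 0$. Let $x_1,\dots,x_K\in\mathbb R^n$ be unit vectors with $$\|x_i-x_j\|_2\ \ge\ C\sqrt{\frac{\log\log d}{\log m}}\qquad\text{for all } i\ne j,$$ and let $y_1,\dots,y_K\in\{0,1\}$ be labels, at most $K_1$ of which equal $1$. Assume that $$K_1\log^5(dK)\le c\,dr,\qquad K\le\exp(c\,m^{1/5}),\qquad K\le\exp(c\,d^{1/5}),\qquad d\le\exp(c\,m^{1/5}).$$ Then there is a map $F\in\mathcal F_{\phi_1,\phi_2,\phi_3}(n,m,d,r)$ such that for every $k=1,\dots,K$: $F(x_k)=0$ if and only if $y_k=0$. (For $K\le 1$ the separation condition is empty and $K_1\log^5(dK)$ is read as $0$ if $K=0$. The constant $c$ is so small that for $K\ge 2$ the assumptions force $d>e$ and $m>1$, so the right-hand side of the separation condition is defined.) -/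

import Mathlib

/-- The two activation functions: the threshold function and the rectified linear unit. -/
inductive Activation where
  | threshold
  | relu

/-- The real function of an activation: `t ↦ 1` if `t > 0` and `0` otherwise (threshold),
respectively `t ↦ max 0 t` (ReLU). -/
noncomputable def Activation.eval (φ : Activation) (t : ℝ) : ℝ :=
  match φ with
  | .threshold => if 0 < t then 1 else 0
  | .relu => max 0 t

/-- `Φ : ℝⁿ → ℝᵐ` is pseudolinear with activation `φ`: there are a weight matrix `V` and a bias
vector `b` with `Φ x = φ (V x - b)`, where `φ` is applied to each coordinate. -/
def IsPseudolinear (φ : Activation) {n m : ℕ}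
    (Φ : EuclideanSpace ℝ (Fin n) → EuclideanSpace ℝ (Fin m)) : Prop :=
  ∃ (V : Matrix (Fin m) (Fin n) ℝ) (b : Fin m → ℝ),
    ∀ (x : EuclideanSpace ℝ (Fin n)) (j : Fin m),
      Φ x j = φ.eval (V.mulVec x.ofLp j - b j)

/-- The class of maps `ℝⁿ → ℝʳ` computable by the four-layer architecture `[n, m, d, r]` whose
three successive pseudolinear maps use the activations `φ₁`, `φ₂`, `φ₃`. The union over all
choices of activations is the class `𝓕(n, m, d, r)`. -/
def NetworkClass (φ₁ φ₂ φ₃ : Activation) (n m d r : ℕ) :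
    Set (EuclideanSpace ℝ (Fin n) → EuclideanSpace ℝ (Fin r)) :=
  {F | ∃ (Φ₁ : EuclideanSpace ℝ (Fin n) → EuclideanSpace ℝ (Fin m))
      (Φ₂ : EuclideanSpace ℝ (Fin m) → EuclideanSpace ℝ (Fin d))
      (Φ₃ : EuclideanSpace ℝ (Fin d) → EuclideanSpace ℝ (Fin r)),
      IsPseudolinear φ₁ Φ₁ ∧ IsPseudolinear φ₂ Φ₂ ∧ IsPseudolinear φ₃ Φ₃ ∧
        F = Φ₃ ∘ Φ₂ ∘ Φ₁}

/-! Two layers of random Gaussian threshold neurons make the data nearly orthogonal and then nearly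
independent; the third layer sums over groups of label-one points.

In the first layer a unit vector activates the set of half-spaces containing it. At threshold `√(log
X)`, with `X` of order `m^(1/5)`, the separation makes two half-spaces overlap by a factor `1/ℓ²`
less than their measure (`ℓ = log d`). So all activated sets have nearly one size `μ`, and pairwise
intersections are at most `μ/(2ℓ)` (`exists_first_layer`). The second layer repeats this on the
indicator vectors. Near-orthogonality to order `1/ℓ` survives at thresholds `b` with `b² ≤ 2ℓ`:
single events have probability at least about `a = exp(-b²/2)`, up to a factor `1/L` with `L =
log(dK)`, while joint events have probability `O(a²)`. With `a` of order `L²/d`, even a union of `N`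
activated sets meets the set of an outside point in fewer neurons than that point activates
(`exists_second_layer`).

The label-one points are split into `r` groups of size at most `N = K₁/r + 1`. Output neuron `j`
counts the active neurons in the union for group `j`; one bias separates members from label-zero
points.

Every random choice rests on `exists_sample_counts`, a Chernoff bound for all events at once. ReLU
is reduced to thresholds by pairing neurons, which costs half the width. -/

/-! ### Sampling and a simultaneous Chernoff bound -/

open MeasureTheory ProbabilityTheory in
/-- Derandomisation by conditional expectations. -/
theorem exists_sample_sum_le {Ω ι : Type*} [MeasurableSpace Ω] (μ : Measure Ω)
    [IsProbabilityMeasure μ] [Fintype ι] (f : ι → Ω → ℝ) (a : ι → ℝ)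
    (hf : ∀ i, Integrable (f i) μ) (h0 : ∀ i ω, 0 ≤ f i ω) (ha : ∀ i, ∫ ω, f i ω ∂μ ≤ a i)
    (m : ℕ) (c : ι → ℝ) (hc : ∀ i, 0 ≤ c i) :
    ∃ ω : Fin m → Ω, ∑ i, c i * ∏ j, f i (ω j) ≤ ∑ i, c i * a i ^ m := by
  have ha0 : ∀ i, 0 ≤ a i := fun i => (integral_nonneg (h0 i)).trans (ha i)
  induction m generalizing c with
  | zero => exact ⟨Fin.elim0, by simp⟩
  | succ m ih =>
    -- The first sample is fixed while the later factors are replaced by their mean bounds; its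
    -- values then join the weights.
    obtain ⟨ω₀, h⟩ := exists_le_integral (μ := μ) (f := fun ω => ∑ i, c i * a i ^ m * f i ω)
      (integrable_finsetSum _ fun i _ => (hf i).const_mul _)
    rw [integral_finsetSum _ fun i _ => (hf i).const_mul _] at h
    simp_rw [integral_const_mul] at h
    obtain ⟨ω, hω⟩ := ih (fun i => c i * f i ω₀) fun i => mul_nonneg (hc i) (h0 i _)
    refine ⟨Fin.cons ω₀ ω, ?_⟩
    simp only [Fin.prod_univ_succ, Fin.cons_zero, Fin.cons_succ]
    calc ∑ i, c i * (f i ω₀ * ∏ j, f i (ω j)) = ∑ i, c i * f i ω₀ * ∏ j, f i (ω j) := by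
          simp only [mul_assoc]
      _ ≤ ∑ i, c i * f i ω₀ * a i ^ m := hω
      _ = ∑ i, c i * a i ^ m * f i ω₀ := Finset.sum_congr rfl fun i _ => by ring
      _ ≤ _ := h.trans (Finset.sum_le_sum fun i _ => by
          rw [pow_succ, ← mul_assoc]
          exact mul_le_mul_of_nonneg_left (ha i) (mul_nonneg (hc i) (pow_nonneg (ha0 i) m)))

open MeasureTheory ProbabilityTheory Classical in
/-- A simultaneous Chernoff bound: upper tails for `0 < l i`, lower tails for `l i < 0`. -/
theorem exists_sample_counts {Ω ι : Type*} [MeasurableSpace Ω] (μ : Measure Ω)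
    [IsProbabilityMeasure μ] [Fintype ι] (E : ι → Set Ω) (hE : ∀ i, MeasurableSet (E i))
    (p l : ι → ℝ) (hl : ∀ i, |l i| ≤ 1) (hp : ∀ i, 0 ≤ p i)
    (hlp : ∀ i, l i * μ.real (E i) ≤ l i * p i) (m : ℕ) (τ : ℝ)
    (hτ : ∀ i, τ ≤ m * (l i ^ 2 * p i)) (hcard : (Fintype.card ι : ℝ) * Real.exp (-τ) < 1) :
    ∃ ω : Fin m → Ω, ∀ i (T : Finset (Fin m)), (∀ j, j ∈ T ↔ ω j ∈ E i) →
      l i * (T.card : ℝ) < l i * ((1 + 2 * l i) * (m * p i)) := by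
  -- The product of `f i` over the samples is below `1` exactly when the desired count inequality
  -- holds. Its mean per sample is at most `exp(-l² p)` because `exp l - 1 ≤ l + l²` for `|l| ≤ 1`.
  set f : ι → Ω → ℝ := fun i ω =>
    ((E i).indicator (fun _ => Real.exp (l i) - 1) ω + 1) * Real.exp (-(l i * ((1 + 2 * l i) * p i)))
    with hfdef
  have hval : ∀ i ω, f i ω = Real.exp (l i * ((if ω ∈ E i then 1 else 0) - (1 + 2 * l i) * p i)) := by
    intro i ω
    by_cases h : ω ∈ E i
    · simp only [hfdef, h, Set.indicator_of_mem, if_true, sub_add_cancel]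
      rw [← Real.exp_add]; congr 1; ring
    · simp only [hfdef, h, Set.indicator_of_notMem, if_false, not_false_eq_true]
      rw [zero_add, one_mul]; congr 1; ring
  have hint : ∀ i, Integrable ((E i).indicator (fun _ : Ω => Real.exp (l i) - 1)) μ :=
    fun i => (integrable_const _).indicator (hE i)
  have hmean : ∀ i, ∫ ω, f i ω ∂μ ≤ Real.exp (-(l i ^ 2 * p i)) := by
    intro i
    rw [hfdef]
    simp only
    rw [integral_mul_const, integral_add (hint i) (integrable_const _),
      integral_indicator_const _ (hE i)]
    simp only [smul_eq_mul, integral_const, probReal_univ, one_mul]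
    have h2 : Real.exp (l i) - 1 ≤ l i + l i ^ 2 := by
      have := (abs_le.1 (Real.abs_exp_sub_one_sub_id_le (hl i))).2
      linarith
    have h3 : μ.real (E i) * (Real.exp (l i) - 1) ≤ p i * (Real.exp (l i) - 1) := by
      rcases le_or_gt 0 (l i) with h | h
      · rcases h.eq_or_lt with h | h
        · simp [← h]
        · exact mul_le_mul_of_nonneg_right (le_of_mul_le_mul_left (hlp i) h)
            (by linarith [Real.add_one_le_exp (l i)])
      · exact mul_le_mul_of_nonpos_right (by nlinarith [hlp i])
          (by linarith [Real.exp_lt_one_iff.2 h])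
    have h4 : p i * (Real.exp (l i) - 1) ≤ p i * (l i + l i ^ 2) :=
      mul_le_mul_of_nonneg_left h2 (hp i)
    calc _ ≤ Real.exp (p i * (l i + l i ^ 2)) * Real.exp (-(l i * ((1 + 2 * l i) * p i))) := by
          gcongr
          have := Real.add_one_le_exp (p i * (l i + l i ^ 2))
          linarith
      _ = _ := by rw [← Real.exp_add]; congr 1; ring
  obtain ⟨ω, hω⟩ := exists_sample_sum_le μ f (fun i => Real.exp (-(l i ^ 2 * p i)))
    (fun i => ((hint i).add (integrable_const _)).mul_const _)
    (fun i ω => by rw [hval]; positivity) hmean m (fun _ => 1) (fun _ => zero_le_one)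
  refine ⟨ω, fun i T hT => ?_⟩
  have h1 : ∏ j, f i (ω j) < 1 := by
    calc ∏ j, f i (ω j) ≤ ∑ i, 1 * ∏ j, f i (ω j) := by
          simp only [one_mul]
          exact Finset.single_le_sum (f := fun i => ∏ j, f i (ω j))
            (fun i _ => Finset.prod_nonneg fun j _ => by rw [hval]; positivity) (Finset.mem_univ i)
      _ ≤ _ := hω
      _ ≤ ∑ i : ι, Real.exp (-τ) := Finset.sum_le_sum fun i _ => by
          rw [one_mul, ← Real.exp_nat_mul]
          exact Real.exp_le_exp.2 (by linarith [hτ i])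
      _ < 1 := by simpa using hcard
  simp_rw [hval, ← Real.exp_sum] at h1
  rw [Real.exp_lt_one_iff, ← Finset.mul_sum, Finset.sum_sub_distrib, Finset.sum_boole] at h1
  simp only [Finset.sum_const, Finset.card_univ, Fintype.card_fin, nsmul_eq_mul] at h1
  have h2 : (Finset.univ.filter fun j => ω j ∈ E i) = T := by ext j; simp [hT]
  rw [h2] at h1
  linarith

/-! ### Gaussian tails and half-spaces -/

open MeasureTheory ProbabilityTheory in
/-- The upper tail of the standard Gaussian distribution. -/
noncomputable def gaussTail (b : ℝ) : ℝ := (gaussianReal 0 1).real (Set.Ioi b)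

open MeasureTheory ProbabilityTheory in
theorem gaussTail_antitone : Antitone gaussTail := fun _ _ h =>
  measureReal_mono (Set.Ioi_subset_Ioi h)

open MeasureTheory ProbabilityTheory in
theorem gaussTail_eq_integral (b : ℝ) :
    gaussTail b = ∫ t in Set.Ioi b, (√(2 * Real.pi))⁻¹ * Real.exp (-t ^ 2 / 2) := by
  rw [gaussTail, measureReal_def, gaussianReal_apply_eq_integral _ one_ne_zero,
    ENNReal.toReal_ofReal (integral_nonneg fun t => gaussianPDFReal_nonneg _ _ _)]
  simp [gaussianPDFReal]

open MeasureTheory ProbabilityTheory in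
theorem integrable_gaussDensity :
    Integrable (fun t : ℝ => (√(2 * Real.pi))⁻¹ * Real.exp (-t ^ 2 / 2)) := by
  have := integrable_gaussianPDFReal 0 1
  unfold gaussianPDFReal at this
  simpa using this

-- Shifting by `s` multiplies the density at `t` by `exp(-ts - s²/2)`, which is at most `exp(-bs)`
-- for `t > b`.
open MeasureTheory ProbabilityTheory in
theorem gaussTail_add_le {b s : ℝ} (hs : 0 ≤ s) :
    gaussTail (b + s) ≤ Real.exp (-(b * s)) * gaussTail b := by
  rw [gaussTail_eq_integral, gaussTail_eq_integral, ← integral_const_mul]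
  rw [← integral_indicator measurableSet_Ioi, ← integral_indicator measurableSet_Ioi,
    ← integral_add_right_eq_self _ s]
  refine integral_mono_of_nonneg (.of_forall fun t => ?_)
    ((integrable_gaussDensity.const_mul _).indicator measurableSet_Ioi) (.of_forall fun t => ?_)
  · exact Set.indicator_nonneg (fun _ _ => by positivity) _
  · by_cases h : b < t
    · have h' : b + s < t + s := by linarith
      simp only [Set.indicator, Set.mem_Ioi, h, h', if_true]
      rw [← mul_assoc, mul_comm (Real.exp _), mul_assoc, ← Real.exp_add]
      gcongr
      nlinarith
    · have h' : ¬ b + s < t + s := by linarith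
      simp only [Set.indicator, Set.mem_Ioi, h, h', if_false]
      exact le_rfl

open MeasureTheory ProbabilityTheory in
theorem gaussTail_le {b : ℝ} (hb : 0 ≤ b) : gaussTail b ≤ Real.exp (-b ^ 2 / 2) := by
  have h := measure_ge_le_exp_mul_mgf (μ := gaussianReal 0 1) (X := id) (t := b) b hb
    (integrable_exp_mul_gaussianReal b)
  rw [mgf_id_gaussianReal] at h
  refine (measureReal_mono (fun x hx => (le_of_lt hx : b ≤ x))).trans (h.trans (le_of_eq ?_))
  rw [← Real.exp_add]; congr 1; push_cast; ring

-- On a window of length `1/(b+1)` above `b` the density drops by a factor of at most `e < 3`; the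
-- `12` is this `3` times the bound `√(2π) ≤ 4`.
open MeasureTheory ProbabilityTheory in
theorem le_gaussTail {b : ℝ} (hb : 0 ≤ b) :
    Real.exp (-b ^ 2 / 2) / (12 * (b + 1)) ≤ gaussTail b := by
  set s := (b + 1)⁻¹ with hs
  have hs0 : 0 < s := by positivity
  have hbs : (b + 1) * s = 1 := mul_inv_cancel₀ (by positivity)
  have hsq : √(2 * Real.pi) ≤ 4 := by
    rw [Real.sqrt_le_left (by norm_num)]; nlinarith [Real.pi_le_four]
  have hsq0 : 0 < √(2 * Real.pi) := by positivity
  have h1 : gaussTail b ≥ ∫ t in Set.Ioc b (b + s), (4⁻¹ * (Real.exp (-b ^ 2 / 2) * 3⁻¹) : ℝ) := by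
    rw [gaussTail_eq_integral]
    calc _ ≤ ∫ t in Set.Ioc b (b + s), (√(2 * Real.pi))⁻¹ * Real.exp (-t ^ 2 / 2) := by
          refine setIntegral_mono_on (integrable_const _) integrable_gaussDensity.integrableOn
            measurableSet_Ioc fun t ht => ?_
          have h3 : (3⁻¹ : ℝ) ≤ Real.exp (-1) := by
            rw [Real.exp_neg]
            exact inv_anti₀ (Real.exp_pos _) (by linarith [Real.exp_one_lt_d9])
          have h4 : Real.exp (-b ^ 2 / 2) * Real.exp (-1) ≤ Real.exp (-t ^ 2 / 2) := by
            rw [← Real.exp_add]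
            refine Real.exp_le_exp.2 ?_
            have ht0 : 0 ≤ t := hb.trans ht.1.le
            have : t ^ 2 ≤ (b + s) ^ 2 := pow_le_pow_left₀ ht0 ht.2 2
            nlinarith
          gcongr
          exact (mul_le_mul_of_nonneg_left h3 (Real.exp_pos _).le).trans h4
      _ ≤ _ := setIntegral_mono_set integrable_gaussDensity.integrableOn
            (.of_forall fun t => by positivity) (Filter.Eventually.of_forall fun t ht => ht.1)
  refine le_trans (le_of_eq ?_) h1
  rw [setIntegral_const, measureReal_def, Real.volume_Ioc, add_sub_cancel_left,
    ENNReal.toReal_ofReal hs0.le, smul_eq_mul, hs]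
  field_simp
  norm_num

open MeasureTheory ProbabilityTheory in
theorem stdGaussian_halfspace {n : ℕ} (v : EuclideanSpace ℝ (Fin n)) (hv : v ≠ 0) (b : ℝ) :
    (stdGaussian (EuclideanSpace ℝ (Fin n))).real {g | b < inner ℝ v g} = gaussTail (b / ‖v‖) := by
  have h0 : (0 : ℝ) < ‖v‖ := norm_pos_iff.2 hv
  have h : (stdGaussian (EuclideanSpace ℝ (Fin n))).map (fun g => (innerSL ℝ (‖v‖⁻¹ • v)) g) =
      gaussianReal 0 1 := by
    rw [IsGaussian.map_eq_gaussianReal, integral_strongDual_stdGaussian,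
      variance_dual_stdGaussian, innerSL_apply_norm, norm_smul]
    simp [h0.ne']
  rw [gaussTail, ← h, measureReal_def, measureReal_def,
    Measure.map_apply (by fun_prop) measurableSet_Ioi]
  congr 2
  ext g
  simp only [Set.mem_ofPred_eq, Set.mem_preimage, Set.mem_Ioi, innerSL_apply_apply, inner_smul_left]
  rw [div_lt_iff₀ h0]
  simp
  field_simp

open MeasureTheory ProbabilityTheory in
theorem stdGaussian_halfspace_le {n : ℕ} (v : EuclideanSpace ℝ (Fin n)) {b ρ : ℝ} (hb : 0 ≤ b)
    (hv : ‖v‖ ≤ ρ) :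
    (stdGaussian (EuclideanSpace ℝ (Fin n))).real {g | b < inner ℝ v g} ≤ gaussTail (b / ρ) := by
  by_cases h : v = 0
  · simp only [h, inner_zero_left, not_lt.2 hb, Set.ofPred_false, measureReal_empty]
    exact measureReal_nonneg
  · rw [stdGaussian_halfspace v h]
    exact gaussTail_antitone (div_le_div_of_nonneg_left hb (norm_pos_iff.2 h) hv)

open MeasureTheory ProbabilityTheory in
theorem le_stdGaussian_halfspace {n : ℕ} (v : EuclideanSpace ℝ (Fin n)) {b ρ : ℝ} (hb : 0 ≤ b)
    (hρ : 0 < ρ) (hv : ρ ≤ ‖v‖) :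
    gaussTail (b / ρ) ≤ (stdGaussian (EuclideanSpace ℝ (Fin n))).real {g | b < inner ℝ v g} := by
  rw [stdGaussian_halfspace v (norm_pos_iff.1 (hρ.trans_le hv))]
  exact gaussTail_antitone (div_le_div_of_nonneg_left hb hρ hv)

-- On the intersection the single functional `v + w` exceeds `2b`, so no joint distribution is
-- needed.
open MeasureTheory ProbabilityTheory in
theorem stdGaussian_halfspace_inter_le {n : ℕ} (v w : EuclideanSpace ℝ (Fin n)) {b ρ : ℝ}
    (hb : 0 ≤ b) (hv : ‖v + w‖ ≤ ρ) :
    (stdGaussian (EuclideanSpace ℝ (Fin n))).real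
      ({g | b < inner ℝ v g} ∩ {g | b < inner ℝ w g}) ≤ gaussTail (2 * b / ρ) := by
  refine le_trans (measureReal_mono fun g hg => ?_)
    (stdGaussian_halfspace_le (v + w) (by positivity) hv)
  simp only [Set.mem_inter_iff, Set.mem_ofPred_eq, inner_add_left] at hg ⊢
  linarith

/-! ### Reduction to threshold networks -/

/-- A threshold of a number outside `(0, 1)` is a combination of two neurons. -/
theorem Activation.exists_decode (φ : Activation) :
    ∃ σ : ℝ, ∀ t : ℝ, (0 < t → 1 ≤ t) → φ.eval t + σ * φ.eval (t - 1) = if 0 < t then 1 else 0 := by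
  cases φ with
  | threshold => exact ⟨0, fun t _ => by simp [Activation.eval]⟩
  | relu =>
    refine ⟨-1, fun t ht => ?_⟩
    simp only [Activation.eval]
    split_ifs with h
    · rw [max_eq_right h.le, max_eq_right (by linarith [ht h])]; ring
    · rw [max_eq_left (not_lt.1 h), max_eq_left (by linarith)]; ring

theorem exists_pos_forall_one_le_mul {ι : Type*} [Finite ι] (t : ι → ℝ) :
    ∃ N : ℝ, 0 < N ∧ ∀ i, 0 < t i → 1 ≤ N * t i := by
  have := Fintype.ofFinite ι
  have h0 : ∀ i ∈ Finset.univ, 0 ≤ |t i|⁻¹ := fun i _ => by positivity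
  have h1 := Finset.sum_nonneg h0
  refine ⟨1 + ∑ i, |t i|⁻¹, by linarith, fun i hi => ?_⟩
  have h2 := Finset.single_le_sum h0 (Finset.mem_univ i)
  calc (1 : ℝ) = |t i|⁻¹ * t i := by rw [abs_of_pos hi, inv_mul_cancel₀ hi.ne']
    _ ≤ _ := mul_le_mul_of_nonneg_right (by linarith) hi.le

/-- On finitely many points, `m'` thresholds are linear functions of `m ≥ 2 * m'` neurons. -/
theorem exists_pseudolinear_decode (φ : Activation) {n m m' K : ℕ} (h : 2 * m' ≤ m)
    (x : Fin K → EuclideanSpace ℝ (Fin n)) (V : Matrix (Fin m') (Fin n) ℝ) (b : Fin m' → ℝ) :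
    ∃ Φ : EuclideanSpace ℝ (Fin n) → EuclideanSpace ℝ (Fin m), IsPseudolinear φ Φ ∧
      ∃ B : Matrix (Fin m') (Fin m) ℝ, ∀ k i,
        B.mulVec (Φ (x k)).ofLp i = if b i < V.mulVec (x k).ofLp i then 1 else 0 := by
  obtain ⟨σ, hσ⟩ := φ.exists_decode
  obtain ⟨N, hN0, hN⟩ := exists_pos_forall_one_le_mul
    (fun q : Fin K × Fin m' => V.mulVec (x q.1).ofLp q.2 - b q.2)
  -- Neurons `2i` and `2i+1` carry the same scaled weights, with biases differing by `1`. The scale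
  -- `N` keeps all data values out of `(0, 1)`, so the pair decodes linearly to a threshold.
  let V' : Matrix (Fin m) (Fin n) ℝ := fun j l =>
    if hj : j.val / 2 < m' then N * V ⟨j.val / 2, hj⟩ l else 0
  let b' : Fin m → ℝ := fun j =>
    if hj : j.val / 2 < m' then N * b ⟨j.val / 2, hj⟩ + ((j.val % 2 : ℕ) : ℝ) else 0
  let e₀ : Fin m' → Fin m := fun i => ⟨2 * i.val, by omega⟩
  let e₁ : Fin m' → Fin m := fun i => ⟨2 * i.val + 1, by omega⟩
  have hV₀ : ∀ i, V' (e₀ i) = N • V i := fun i => by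
    ext l; simp [V', e₀]
  have hV₁ : ∀ i, V' (e₁ i) = N • V i := fun i => by
    have h2 : (2 * i.val + 1) / 2 = i.val := by omega
    ext l; simp [V', e₁, h2]
  have hb₀ : ∀ i, b' (e₀ i) = N * b i := fun i => by simp [b', e₀]
  have hb₁ : ∀ i, b' (e₁ i) = N * b i + 1 := fun i => by
    have h2 : (2 * i.val + 1) / 2 = i.val := by omega
    have h3 : (2 * i.val + 1) % 2 = 1 := by omega
    simp [b', e₁, h2, h3]
  refine ⟨fun z => WithLp.toLp 2 fun j => φ.eval (V'.mulVec z.ofLp j - b' j),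
    ⟨V', b', fun _ _ => rfl⟩,
    fun i j => (if j = e₀ i then 1 else 0) + (if j = e₁ i then σ else 0), fun k i => ?_⟩
  have h4 := hσ (N * (V.mulVec (x k).ofLp i - b i))
    (fun hpos => hN (k, i) (pos_of_mul_pos_right hpos hN0.le))
  simp only [Matrix.mulVec, dotProduct, add_mul, Finset.sum_add_distrib, ite_mul, one_mul, zero_mul,
    Finset.sum_ite_eq', Finset.mem_univ, if_true, hV₀, hV₁, hb₀, hb₁,
    Pi.smul_apply, smul_eq_mul, mul_assoc, ← Finset.mul_sum] at h4 ⊢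
  rw [mul_sub] at h4
  rw [← sub_sub, h4, ← mul_sub]
  simp only [mul_pos_iff_of_pos_left hN0, sub_pos]

/-- Networks with the given activations simulate threshold networks of half the width on finite
data. -/
theorem exists_network_of_thresholds (φ₁ φ₂ φ₃ : Activation) {n m d r m' d' K : ℕ}
    (hm : 2 * m' ≤ m) (hd : 2 * d' ≤ d) (x : Fin K → EuclideanSpace ℝ (Fin n))
    (V : Matrix (Fin m') (Fin n) ℝ) (b : Fin m' → ℝ) (W : Matrix (Fin d') (Fin m') ℝ)
    (c : Fin d' → ℝ) (U : Matrix (Fin r) (Fin d') ℝ) (e : Fin r → ℝ)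
    (u : Fin K → Fin m' → ℝ) (hu : ∀ k i, u k i = if b i < V.mulVec (x k).ofLp i then 1 else 0)
    (v : Fin K → Fin d' → ℝ) (hv : ∀ k i, v k i = if c i < W.mulVec (u k) i then 1 else 0) :
    ∃ F ∈ NetworkClass φ₁ φ₂ φ₃ n m d r, ∀ k j,
      F (x k) j = φ₃.eval (U.mulVec (v k) j - e j) := by
  obtain ⟨Φ₁, hΦ₁, B₁, hB₁⟩ := exists_pseudolinear_decode φ₁ hm x V b
  have h1 : ∀ k, B₁.mulVec (Φ₁ (x k)).ofLp = u k := fun k => funext fun i => by rw [hB₁, hu]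
  obtain ⟨Φ₂, hΦ₂, B₂, hB₂⟩ := exists_pseudolinear_decode φ₂ hd (fun k => Φ₁ (x k)) (W * B₁) c
  have h2 : ∀ k, B₂.mulVec (Φ₂ (Φ₁ (x k))).ofLp = v k := fun k => funext fun i => by
    rw [hB₂, hv, ← Matrix.mulVec_mulVec, h1]
  refine ⟨_, ⟨Φ₁, Φ₂, fun z => WithLp.toLp 2 fun j => φ₃.eval ((U * B₂).mulVec z.ofLp j - e j),
    hΦ₁, hΦ₂, ⟨U * B₂, e, fun _ _ => rfl⟩, rfl⟩, fun k j => ?_⟩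
  simp only [Function.comp_apply]
  rw [← Matrix.mulVec_mulVec, h2]

theorem Activation.eval_eq_zero_iff (φ : Activation) (t : ℝ) : φ.eval t = 0 ↔ t ≤ 0 := by
  cases φ <;> simp [Activation.eval]

theorem exists_constant_network (φ₁ φ₂ φ₃ : Activation) {n m d r : ℕ} (hr : 0 < r) (y : Fin 2) :
    ∃ F ∈ NetworkClass φ₁ φ₂ φ₃ n m d r, ∀ x, F x = 0 ↔ y = 0 := by
  have hps : ∀ (φ : Activation) {p q : ℕ} (b : ℝ), IsPseudolinear φ
      (fun _ : EuclideanSpace ℝ (Fin p) => (WithLp.toLp 2 fun _ => φ.eval b :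
        EuclideanSpace ℝ (Fin q))) := fun φ p q b =>
    ⟨0, fun _ => -b, fun _ _ => by simp⟩
  refine ⟨_, ⟨_, _, _, hps φ₁ 0, hps φ₂ 0, hps φ₃ (if y = 0 then 0 else 1), rfl⟩, fun x => ?_⟩
  have h : φ₃.eval (if y = 0 then 0 else 1) = 0 ↔ y = 0 := by
    rw [Activation.eval_eq_zero_iff]
    split_ifs with h <;> simp [h]
  refine Iff.trans ?_ h
  constructor
  · intro h0
    exact congrArg (fun z : EuclideanSpace ℝ (Fin r) => z ⟨0, hr⟩) h0
  · intro h0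
    ext j
    exact h0

/-! ### First layer: separated points to nearly orthogonal sets -/

/-- This form turns the threshold `2b/ρ` of a joint event into `b + bt/8`, with `t = ‖v - w‖²`,
ready for `gaussTail_add_le`. -/
theorem norm_add_le_of_unit {E : Type*} [NormedAddCommGroup E] [InnerProductSpace ℝ E] {v w : E}
    (hv : ‖v‖ = 1) (hw : ‖w‖ = 1) : ‖v + w‖ ≤ 2 / (1 + ‖v - w‖ ^ 2 / 8) := by
  have h := parallelogram_law_with_norm ℝ v w
  rw [hv, hw] at h
  set t := ‖v - w‖ ^ 2 with ht
  have ht0 : 0 ≤ t := by positivity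
  have h1 : ‖v + w‖ ^ 2 = 4 - t := by rw [ht]; linarith
  have ht4 : t ≤ 4 := by nlinarith [sq_nonneg ‖v + w‖]
  rw [le_div_iff₀ (by positivity)]
  refine le_of_sq_le_sq ?_ (by norm_num)
  rw [mul_pow, h1]
  nlinarith [mul_nonneg ht0 ht0, mul_nonneg (mul_nonneg ht0 ht0) ht0]

open MeasureTheory ProbabilityTheory in
/-- Random half-spaces map separated unit vectors to sets of nearly equal sizes with small
intersections. -/
theorem exists_first_layer {n m K : ℕ} {X ℓ : ℝ} (hX : 4000 ≤ X) (hℓ : 4 ≤ ℓ) (hℓX : ℓ ≤ X)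
    (hm : X ^ 5 / 3 ≤ m) (hK : (K : ℝ) ≤ Real.exp X) (x : Fin K → EuclideanSpace ℝ (Fin n))
    (hx : ∀ k, ‖x k‖ = 1)
    (hsep : ∀ i j, i ≠ j → 20 * Real.log ℓ / Real.log X ≤ ‖x i - x j‖ ^ 2) :
    ∃ (V : Matrix (Fin m) (Fin n) ℝ) (b μ : ℝ) (T : Fin K → Finset (Fin m)), 0 < μ ∧
      (∀ k i, i ∈ T k ↔ b < V.mulVec (x k).ofLp i) ∧
      (∀ k, (1 - 1 / (2 * ℓ)) * μ ≤ (T k).card ∧ ((T k).card : ℝ) ≤ (1 + 1 / (2 * ℓ)) * μ) ∧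
      ∀ i j, i ≠ j → ((T i ∩ T j).card : ℝ) ≤ 1 / (2 * ℓ) * μ := by
  classical
  have hX0 : 0 < X := by linarith
  have hℓ0 : 0 < ℓ := by linarith
  have hlogX : 0 < Real.log X := Real.log_pos (by linarith)
  have hlogℓ : 0 < Real.log ℓ := Real.log_pos (by linarith)
  set b := √(Real.log X) with hb
  have hb0 : 0 < b := Real.sqrt_pos.2 hlogX
  have hbsq : b ^ 2 = Real.log X := Real.sq_sqrt hlogX.le
  set p := gaussTail b with hp
  have hpX : 1 / (24 * X) ≤ p := by
    refine le_trans ?_ (le_gaussTail hb0.le)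
    have h1 : Real.exp (-b ^ 2 / 2) = (√X)⁻¹ := by
      rw [hbsq, neg_div, Real.exp_neg, Real.exp_half, Real.exp_log hX0]
    have h2 : b ≤ √X := Real.sqrt_le_sqrt (Real.log_le_self hX0.le)
    have h3 : 1 ≤ √X := Real.one_le_sqrt.2 (by linarith)
    have h4 : √X * √X = X := Real.mul_self_sqrt hX0.le
    rw [h1, div_le_div_iff₀ (by positivity) (by positivity), one_mul, ← div_eq_inv_mul,
      le_div_iff₀ (by positivity)]
    nlinarith
  have hp0 : 0 < p := lt_of_lt_of_le (by positivity) hpX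
  have hmp : X ^ 4 / 72 ≤ m * p := by
    calc X ^ 4 / 72 = X ^ 5 / 3 * (1 / (24 * X)) := by field_simp; norm_num
      _ ≤ _ := mul_le_mul hm hpX (by positivity) (by positivity)
  have hm0 : 0 < (m : ℝ) := lt_of_lt_of_le (by positivity) hm
  let H : Fin K → Set (EuclideanSpace ℝ (Fin n)) := fun k => {g | b < inner ℝ (x k) g}
  have hHm : ∀ k, MeasurableSet (H k) := fun k =>
    measurableSet_lt measurable_const (by fun_prop)
  set γ := stdGaussian (EuclideanSpace ℝ (Fin n)) with hγ
  have hH : ∀ k, γ.real (H k) = p := fun k => by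
    have h1 := stdGaussian_halfspace (x k) (norm_ne_zero_iff.1 (by rw [hx]; exact one_ne_zero)) b
    rw [hx, div_one] at h1
    exact h1
  have hHH : ∀ i j, i ≠ j → γ.real (H i ∩ H j) ≤ 1 / (4 * ℓ) * p := fun i j hij => by
    refine (stdGaussian_halfspace_inter_le (x i) (x j) hb0.le
      (norm_add_le_of_unit (hx i) (hx j))).trans ?_
    set t := ‖x i - x j‖ ^ 2 with ht
    have h1 : 2 * b / (2 / (1 + t / 8)) = b + b * t / 8 := by field_simp
    rw [h1]
    refine (gaussTail_add_le (by positivity)).trans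
      (mul_le_mul_of_nonneg_right ?_ hp0.le)
    have h2 : 20 * Real.log ℓ ≤ t * Real.log X := (div_le_iff₀ hlogX).1 (hsep i j hij)
    calc Real.exp (-(b * (b * t / 8))) ≤ Real.exp (-(Real.log ℓ + Real.log ℓ)) := by
          refine Real.exp_le_exp.2 ?_
          have : b * (b * t / 8) = t * Real.log X / 8 := by rw [← hbsq]; ring
          rw [this]; linarith
      _ = 1 / (ℓ * ℓ) := by
          rw [Real.exp_neg, Real.exp_add, Real.exp_log hℓ0, one_div]
      _ ≤ _ := one_div_le_one_div_of_le (by positivity) (by nlinarith)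
  let E : Fin K ⊕ Fin K ⊕ {q : Fin K × Fin K // q.1 ≠ q.2} → Set (EuclideanSpace ℝ (Fin n)) :=
    Sum.elim H (Sum.elim H fun q => H q.1.1 ∩ H q.1.2)
  -- Chernoff parameters `±η` allow relative deviation `2η = 1/(2ℓ)`; for pairs, parameter `1/2`
  -- doubles the bound `ηp`. Exponents of at least `3X` cover the `O(K²)` events, since `K ≤ exp X`.
  set η := 1 / (4 * ℓ) with hη
  have hη0 : 0 < η := by positivity
  have hη1 : η ≤ 1 := by rw [hη, div_le_one (by positivity)]; linarith
  have hηX : 1 / (4 * X) ≤ η := one_div_le_one_div_of_le (by positivity) (by linarith)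
  have hτ₁ : 3 * X ≤ m * (η ^ 2 * p) := by
    calc 3 * X ≤ (1 / (4 * X)) ^ 2 * (X ^ 4 / 72) := by
          have : (1 / (4 * X)) ^ 2 * (X ^ 4 / 72) = X * X / 1152 := by field_simp; norm_num
          rw [this]; nlinarith
      _ ≤ η ^ 2 * (m * p) := by gcongr
      _ = _ := by ring
  have hτ₂ : 3 * X ≤ m * ((1 / 2) ^ 2 * (η * p)) := by
    calc 3 * X ≤ (1 / (4 * X)) * (X ^ 4 / 72) / 4 := by
          have : (1 / (4 * X)) * (X ^ 4 / 72) / 4 = X * (X * X) / 1152 := by field_simp; norm_num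
          rw [this]
          have : 4000 * 4000 ≤ X * X := mul_le_mul hX hX (by norm_num) hX0.le
          nlinarith
      _ ≤ η * (m * p) / 4 := by gcongr
      _ = _ := by ring
  obtain ⟨g, hg⟩ := exists_sample_counts γ E
    (by rintro (k | k | q) <;> simp only [E, Sum.elim_inl, Sum.elim_inr]
        exacts [hHm k, hHm k, (hHm _).inter (hHm _)])
    (Sum.elim (fun _ => p) (Sum.elim (fun _ => p) fun _ => η * p))
    (Sum.elim (fun _ => -η) (Sum.elim (fun _ => η) fun _ => 1 / 2))
    (by rintro (k | k | q) <;> simp only [Sum.elim_inl, Sum.elim_inr]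
        · rwa [abs_neg, abs_of_pos hη0]
        · rwa [abs_of_pos hη0]
        · norm_num [abs_of_pos])
    (by rintro (k | k | q) <;> simp only [Sum.elim_inl, Sum.elim_inr] <;> positivity)
    (by rintro (k | k | q) <;> simp only [E, Sum.elim_inl, Sum.elim_inr, hH, le_refl]
        exact mul_le_mul_of_nonneg_left (hHH _ _ q.2) (by norm_num))
    m (3 * X)
    (by rintro (k | k | q) <;> simp only [Sum.elim_inl, Sum.elim_inr, neg_sq] <;> assumption)
    (by
      have h1 : Fintype.card {q : Fin K × Fin K // q.1 ≠ q.2} ≤ K * K :=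
        (Fintype.card_subtype_le _).trans (by simp)
      have h1' : (Fintype.card {q : Fin K × Fin K // q.1 ≠ q.2} : ℝ) ≤ K * K := by exact_mod_cast h1
      simp only [Fintype.card_sum, Fintype.card_fin]
      push_cast
      have h2 : (1 : ℝ) ≤ Real.exp X := Real.one_le_exp hX0.le
      have h3 : 3 < Real.exp X := by linarith [Real.add_one_le_exp X]
      have h4 : (K : ℝ) * K ≤ Real.exp X * Real.exp X :=
        mul_le_mul hK hK (by positivity) (by positivity)
      have h5 : Real.exp (-(3 * X)) = 1 / (Real.exp X * Real.exp X * Real.exp X) := by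
        rw [Real.exp_neg, one_div, ← Real.exp_add, ← Real.exp_add]; congr 2; ring
      rw [h5, ← div_eq_mul_one_div, div_lt_one (by positivity)]
      nlinarith [mul_pos (Real.exp_pos X) (Real.exp_pos X)])
  have hcoord : ∀ k i, (Matrix.of fun i => (g i).ofLp).mulVec (x k).ofLp i = inner ℝ (x k) (g i) :=
    fun k i => by simp [Matrix.mulVec, dotProduct, PiLp.inner_apply]
  have h2η : 1 / (2 * ℓ) = 2 * η := by rw [hη]; field_simp; norm_num
  let T : Fin K → Finset (Fin m) := fun k => Finset.univ.filter fun i => g i ∈ H k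
  have hT : ∀ k i, i ∈ T k ↔ g i ∈ H k := fun k i => by simp [T]
  refine ⟨Matrix.of fun i => (g i).ofLp, b, m * p, T, mul_pos hm0 hp0, fun k i => ?_,
    fun k => ⟨?_, ?_⟩, fun i j hij => ?_⟩
  · rw [hcoord, hT]; rfl
  · have h1 := hg (Sum.inl k) (T k) (hT k)
    simp only [Sum.elim_inl] at h1
    have h2 := lt_of_mul_lt_mul_left (by linarith : η * ((1 + 2 * -η) * (m * p)) <
      η * ((T k).card : ℝ)) hη0.le
    rw [h2η]; linarith
  · have h1 := hg (Sum.inr (Sum.inl k)) (T k) (hT k)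
    simp only [Sum.elim_inl, Sum.elim_inr] at h1
    rw [h2η]; exact (lt_of_mul_lt_mul_left h1 hη0.le).le
  · have h1 := hg (Sum.inr (Sum.inr ⟨(i, j), hij⟩)) (T i ∩ T j)
      (fun l => by rw [Finset.mem_inter, hT, hT]; rfl)
    simp only [Sum.elim_inr] at h1
    rw [h2η]; linarith

/-! ### Second layer: nearly orthogonal sets to nearly independent ones -/

/-- The indicator vector of a finite set of coordinates. -/
noncomputable def indVec {m : ℕ} (T : Finset (Fin m)) : EuclideanSpace ℝ (Fin m) :=
  WithLp.toLp 2 fun i => if i ∈ T then 1 else 0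

theorem inner_indVec {m : ℕ} (S T : Finset (Fin m)) :
    inner ℝ (indVec S) (indVec T) = ((S ∩ T).card : ℝ) := by
  simp [indVec, PiLp.inner_apply, Finset.inter_comm]

theorem norm_indVec_sq {m : ℕ} (T : Finset (Fin m)) : ‖indVec T‖ ^ 2 = (T.card : ℝ) := by
  rw [← real_inner_self_eq_norm_sq, inner_indVec, Finset.inter_self]

theorem norm_indVec_add_sq {m : ℕ} (S T : Finset (Fin m)) :
    ‖indVec S + indVec T‖ ^ 2 = (S.card : ℝ) + 2 * ((S ∩ T).card : ℝ) + (T.card : ℝ) := by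
  rw [norm_add_sq_real, norm_indVec_sq, norm_indVec_sq, inner_indVec]

-- Since `b² η ≤ 1`, the norm error raises the squared threshold by at most `2`, a factor `e < 3` in
-- the tail. The rescaled threshold plus one is at most `3L`, giving `108 = 3 · 12 · 3`.
open MeasureTheory ProbabilityTheory in
theorem le_stdGaussian_halfspace_of_norm_sq {n : ℕ} {v : EuclideanSpace ℝ (Fin n)}
    {b η μ L : ℝ} (hb : 0 ≤ b) (hη1 : η ≤ 1 / 8) (hbη : b ^ 2 * η ≤ 1) (hμ : 0 < μ)
    (hL : 1 ≤ L) (hbL : b ≤ L) (hv : (1 - η) * μ ≤ ‖v‖ ^ 2) :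
    Real.exp (-b ^ 2 / 2) / (108 * L) ≤
      (stdGaussian (EuclideanSpace ℝ (Fin n))).real {w | b * √μ < inner ℝ v w} := by
  have h1η : 0 < 1 - η := by linarith
  have hsμ : 0 < √μ := Real.sqrt_pos.2 hμ
  have hs : 0 < √(1 - η) := Real.sqrt_pos.2 h1η
  have hs2 : √(1 - η) ^ 2 = 1 - η := Real.sq_sqrt h1η.le
  have hs1 : 1 / 2 ≤ √(1 - η) := Real.le_sqrt_of_sq_le (by linarith)
  refine le_trans ?_ (le_stdGaussian_halfspace v (ρ := √(1 - η) * √μ)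
    (by positivity) (by positivity) ?_)
  · rw [mul_div_mul_right _ _ hsμ.ne']
    set b' := b / √(1 - η) with hb'
    have hb'2 : b' ≤ 2 * b := by
      rw [hb', div_le_iff₀ hs]; nlinarith
    have hb'0 : 0 ≤ b' := by positivity
    refine le_trans ?_ (le_gaussTail hb'0)
    have h2 : b' ^ 2 ≤ b ^ 2 + 2 := by
      rw [hb', div_pow, hs2, div_le_iff₀ h1η]; linarith
    have h3 : Real.exp (-b ^ 2 / 2) / 3 ≤ Real.exp (-b' ^ 2 / 2) := by
      calc Real.exp (-b ^ 2 / 2) / 3 ≤ Real.exp (-b ^ 2 / 2) * Real.exp (-1) := by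
            rw [Real.exp_neg 1, ← div_eq_mul_inv]
            exact div_le_div_of_nonneg_left (Real.exp_pos _).le (Real.exp_pos _)
              (by linarith [Real.exp_one_lt_d9])
        _ ≤ _ := by rw [← Real.exp_add]; exact Real.exp_le_exp.2 (by linarith)
    have h4 : Real.exp (-b ^ 2 / 2) / (108 * L) = Real.exp (-b ^ 2 / 2) / 3 / (12 * (3 * L)) := by
      rw [div_div]; congr 1; ring
    rw [h4]
    exact div_le_div₀ (Real.exp_pos _).le h3 (by positivity) (by linarith)
  · refine le_of_sq_le_sq ?_ (norm_nonneg _)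
    rw [mul_pow, hs2, Real.sq_sqrt hμ.le]
    exact hv

-- For exactly orthogonal vectors the exponent would be `-b²`; the errors cost at most `e² ≤ 9`
-- since `b² η ≤ 1`.
open MeasureTheory ProbabilityTheory in
theorem stdGaussian_halfspace_inter_le_of_norm_sq {n : ℕ} {v w : EuclideanSpace ℝ (Fin n)}
    {b η μ : ℝ} (hb : 0 ≤ b) (hη0 : 0 ≤ η) (hbη : b ^ 2 * η ≤ 1) (hμ : 0 < μ)
    (hvw : ‖v + w‖ ^ 2 ≤ 2 * (1 + 2 * η) * μ) :
    (stdGaussian (EuclideanSpace ℝ (Fin n))).real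
      ({x | b * √μ < inner ℝ v x} ∩ {x | b * √μ < inner ℝ w x}) ≤
        9 * Real.exp (-b ^ 2 / 2) ^ 2 := by
  have hsμ : 0 < √μ := Real.sqrt_pos.2 hμ
  have hs2 : √(2 * (1 + 2 * η)) ^ 2 = 2 * (1 + 2 * η) := Real.sq_sqrt (by positivity)
  refine (stdGaussian_halfspace_inter_le v w (ρ := √(2 * (1 + 2 * η)) * √μ) (by positivity)
    ?_).trans ((gaussTail_le (by positivity)).trans ?_)
  · refine le_of_sq_le_sq ?_ (by positivity)
    rwa [mul_pow, hs2, Real.sq_sqrt hμ.le]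
  · have h1 : (2 * (b * √μ) / (√(2 * (1 + 2 * η)) * √μ)) ^ 2 = 2 * (b ^ 2 / (1 + 2 * η)) := by
      rw [← mul_assoc, mul_div_mul_right _ _ hsμ.ne', div_pow, mul_pow, hs2]
      field_simp
    have h2 : b ^ 2 - 2 ≤ b ^ 2 / (1 + 2 * η) := by
      rw [le_div_iff₀ (by positivity)]; linarith
    have h3 : Real.exp 1 ≤ 3 := by linarith [Real.exp_one_lt_d9]
    calc _ ≤ Real.exp (-b ^ 2 / 2 + -b ^ 2 / 2 + (1 + 1)) := by
          rw [h1]; exact Real.exp_le_exp.2 (by linarith)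
      _ = Real.exp (-b ^ 2 / 2) ^ 2 * (Real.exp 1 * Real.exp 1) := by
          rw [Real.exp_add, Real.exp_add, Real.exp_add, sq (Real.exp _)]
      _ ≤ Real.exp (-b ^ 2 / 2) ^ 2 * (3 * 3) := by gcongr
      _ = _ := by ring

open MeasureTheory ProbabilityTheory in
/-- Random half-spaces map nearly orthogonal sets to sparse sets that are nearly pairwise
independent, hence separate each point from the union of any small group not containing it. -/
theorem exists_second_layer {m D K N : ℕ} {μ ℓ L : ℝ} (hℓ : 4 ≤ ℓ) (hℓL : ℓ ≤ L)
    (hDℓ : (D : ℝ) ≤ Real.exp ℓ) (hK : (K : ℝ) ≤ Real.exp L) (hN : 1 ≤ N)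
    (hND : 21000000 * (N * L ^ 3) ≤ D) (hμ : 0 < μ) (T : Fin K → Finset (Fin m))
    (hT₁ : ∀ k, (1 - 1 / (2 * ℓ)) * μ ≤ (T k).card)
    (hT₂ : ∀ k, ((T k).card : ℝ) ≤ (1 + 1 / (2 * ℓ)) * μ)
    (hTT : ∀ i j, i ≠ j → ((T i ∩ T j).card : ℝ) ≤ 1 / (2 * ℓ) * μ)
    (g : Fin K → Finset (Fin K)) (hg : ∀ k, (g k).card ≤ N) :
    ∃ (W : Matrix (Fin D) (Fin m) ℝ) (c t : ℝ) (S : Fin K → Finset (Fin D)), 0 ≤ t ∧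
      (∀ k i, i ∈ S k ↔ c < W.mulVec (indVec (T k)).ofLp i) ∧
      (∀ k, t < (S k).card) ∧
      ∀ k j, j ∉ g k → ((((g k).biUnion S) ∩ S j).card : ℝ) ≤ t := by
  classical
  have hL : 4 ≤ L := hℓ.trans hℓL
  have hL0 : 0 < L := by linarith
  have hℓ0 : 0 < ℓ := by linarith
  have hN1 : (1 : ℝ) ≤ N := by exact_mod_cast hN
  have hL3 : L ^ 2 ≤ N * L ^ 3 := by
    have : L ^ 2 * 1 ≤ L ^ 2 * (N * L) := mul_le_mul_of_nonneg_left (by nlinarith) (by positivity)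
    linarith
  have hD0 : (0 : ℝ) < D := lt_of_lt_of_le (by positivity) hND
  -- `a` is the target for `exp(-b²/2)`. The factor `5184 = 3 · 1728` makes the Chernoff exponent `D
  -- p / 16` exactly `3L`, where `p = a / (108 L)`; then `9 · 432 · 5184 < 21000000` gives `hNa`.
  set a := 5184 * L ^ 2 / D with ha
  have ha0 : 0 < a := by positivity
  have haD : D * a = 5184 * L ^ 2 := by rw [ha]; field_simp
  have ha1 : a ≤ 1 := by
    rw [ha, div_le_one hD0]; nlinarith [pow_pos hL0 2]
  have hNa : N * 9 * a * (432 * L) ≤ 1 := by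
    rw [ha, mul_div_assoc', div_mul_eq_mul_div, div_le_one hD0]
    have : 0 ≤ N * L ^ 3 := by positivity
    nlinarith
  set b := √(2 * Real.log (1 / a)) with hb
  have hb0 : 0 ≤ b := Real.sqrt_nonneg _
  have hbsq : b ^ 2 = 2 * Real.log (1 / a) :=
    Real.sq_sqrt (mul_nonneg two_pos.le (Real.log_nonneg (one_le_one_div ha0 ha1)))
  have hbℓ : b ^ 2 ≤ 2 * ℓ := by
    rw [hbsq]
    have h1 : Real.log (1 / a) ≤ Real.log (Real.exp ℓ) := by
      refine Real.log_le_log (by positivity) (le_trans ?_ hDℓ)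
      rw [ha, one_div_div]
      exact div_le_self hD0.le (by nlinarith)
    rw [Real.log_exp] at h1
    linarith
  have hexp : Real.exp (-b ^ 2 / 2) = a := by
    rw [hbsq, one_div, Real.log_inv]
    have : -(2 * -Real.log a) / 2 = Real.log a := by ring
    rw [this, Real.exp_log ha0]
  have hbL : b ≤ L := by
    refine le_of_sq_le_sq ?_ hL0.le
    nlinarith
  set η := 1 / (2 * ℓ) with hη
  have hη0 : 0 < η := by positivity
  have hηℓ : η * ℓ = 1 / 2 := by rw [hη]; field_simp
  have hη1 : η ≤ 1 / 8 := by
    rw [hη]; exact one_div_le_one_div_of_le (by norm_num) (by linarith)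
  have hbη : b ^ 2 * η ≤ 1 := by nlinarith
  have hsμ : 0 < √μ := Real.sqrt_pos.2 hμ
  have hsμ2 : √μ ^ 2 = μ := Real.sq_sqrt hμ.le
  set p := a / (108 * L) with hp
  have hp0 : 0 < p := by positivity
  let H : Fin K → Set (EuclideanSpace ℝ (Fin m)) :=
    fun k => {w | b * √μ < inner ℝ (indVec (T k)) w}
  have hHm : ∀ k, MeasurableSet (H k) := fun k =>
    measurableSet_lt measurable_const (by fun_prop)
  set γ := stdGaussian (EuclideanSpace ℝ (Fin m)) with hγ
  have hH : ∀ k, p ≤ γ.real (H k) := fun k => by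
    rw [hp, ← hexp]
    exact le_stdGaussian_halfspace_of_norm_sq hb0 hη1 hbη hμ (by linarith) hbL
      (by rw [norm_indVec_sq]; exact hT₁ k)
  have hHH : ∀ i j, i ≠ j → γ.real (H i ∩ H j) ≤ 9 * a ^ 2 := fun i j hij => by
    rw [← hexp]
    refine stdGaussian_halfspace_inter_le_of_norm_sq hb0 hη0.le hbη hμ ?_
    rw [norm_indVec_add_sq]
    linarith [hT₂ i, hT₂ j, hTT i j hij]
  have hHU : ∀ k j, j ∉ g k → γ.real ((⋃ i ∈ g k, H i) ∩ H j) ≤ p / 4 := fun k j hj => by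
    rw [Set.iUnion₂_inter]
    calc _ ≤ ∑ i ∈ g k, γ.real (H i ∩ H j) := measureReal_biUnion_finset_le _ _
      _ ≤ ∑ i ∈ g k, 9 * a ^ 2 := Finset.sum_le_sum fun i hi =>
          hHH i j fun h => hj (h ▸ hi)
      _ = (g k).card * (9 * a ^ 2) := by simp
      _ ≤ N * (9 * a ^ 2) := by
          have : ((g k).card : ℝ) ≤ N := by exact_mod_cast hg k
          gcongr
      _ ≤ p / 4 := by
          rw [hp, div_div, le_div_iff₀ (by positivity)]
          calc N * (9 * a ^ 2) * (108 * L * 4) = a * (N * 9 * a * (432 * L)) := by ring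
            _ ≤ a * 1 := by gcongr
            _ = a := mul_one a
  let E : Fin K ⊕ {q : Fin K × Fin K // q.2 ∉ g q.1} → Set (EuclideanSpace ℝ (Fin m)) :=
    Sum.elim H fun q => (⋃ i ∈ g q.1.1, H i) ∩ H q.1.2
  have hτ : 3 * L = D * (p / 16) := by
    have : D * (p / 16) = D * a / (1728 * L) := by rw [hp]; field_simp; norm_num
    rw [this, haD]; field_simp; norm_num
  obtain ⟨w, hw⟩ := exists_sample_counts γ E
    (by rintro (k | q) <;> simp only [E, Sum.elim_inl, Sum.elim_inr]
        exacts [hHm k, (Finset.measurableSet_biUnion _ fun i _ => hHm i).inter (hHm _)])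
    -- Parameter `-1/4` gives more than `Dp/2` neurons for each point; parameter `1/2` on mean at
    -- most `Dp/4` gives fewer than `Dp/2` for each group overlap. Both exponents are `Dp/16`.
    (Sum.elim (fun _ => p) fun _ => p / 4) (Sum.elim (fun _ => -(1 / 4)) fun _ => 1 / 2)
    (by rintro (k | q) <;> simp only [Sum.elim_inl, Sum.elim_inr] <;> norm_num [abs_of_pos])
    (by rintro (k | q) <;> simp only [Sum.elim_inl, Sum.elim_inr] <;> positivity)
    (by rintro (k | q) <;> simp only [E, Sum.elim_inl, Sum.elim_inr]
        · linarith [hH k]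
        · linarith [hHU _ _ q.2])
    D (3 * L)
    (by rintro (k | q) <;> simp only [Sum.elim_inl, Sum.elim_inr] <;> rw [hτ] <;> 
          exact le_of_eq (by ring))
    (by
      have h1 : Fintype.card {q : Fin K × Fin K // q.2 ∉ g q.1} ≤ K * K :=
        (Fintype.card_subtype_le _).trans (by simp)
      have h1' : (Fintype.card {q : Fin K × Fin K // q.2 ∉ g q.1} : ℝ) ≤ K * K := by
        exact_mod_cast h1
      simp only [Fintype.card_sum, Fintype.card_fin]
      push_cast
      have h2 : (1 : ℝ) ≤ Real.exp L := Real.one_le_exp hL0.le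
      have h3 : 3 < Real.exp L := by linarith [Real.add_one_le_exp L]
      have h4 : (K : ℝ) * K ≤ Real.exp L * Real.exp L :=
        mul_le_mul hK hK (by positivity) (by positivity)
      have h5 : Real.exp (-(3 * L)) = 1 / (Real.exp L * Real.exp L * Real.exp L) := by
        rw [Real.exp_neg, one_div, ← Real.exp_add, ← Real.exp_add]; congr 2; ring
      rw [h5, ← div_eq_mul_one_div, div_lt_one (by positivity)]
      nlinarith [mul_pos (Real.exp_pos L) (Real.exp_pos L)])
  let S : Fin K → Finset (Fin D) := fun k => Finset.univ.filter fun i => w i ∈ H k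
  have hS : ∀ k i, i ∈ S k ↔ w i ∈ H k := fun k i => by simp [S]
  refine ⟨Matrix.of fun i => (w i).ofLp, b * √μ, D * p / 2, S, by positivity, fun k i => ?_,
    fun k => ?_, fun k j hj => ?_⟩
  · rw [hS]
    simp [H, Matrix.mulVec, dotProduct, PiLp.inner_apply]
  · have h1 := hw (Sum.inl k) (S k) (hS k)
    simp only [Sum.elim_inl] at h1
    linarith
  · have h1 := hw (Sum.inr ⟨(k, j), hj⟩) ((g k).biUnion S ∩ S j)
      (fun l => by
        simp only [E, Sum.elim_inr, Finset.mem_inter, Finset.mem_biUnion, Set.mem_inter_iff,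
          Set.mem_iUnion, hS, exists_prop])
    simp only [Sum.elim_inr] at h1
    linarith

/-! ### Output layer: grouping the points labelled one -/

/-- A finite set of size at most `a` splits into `r` groups of size at most `a / r + 1`. -/
theorem exists_grouping {α : Type*} (A : Finset α) {a r : ℕ} (hA : A.card ≤ a)
    (hr : 0 < r) : ∃ g : α → Fin r, ∀ B : Finset α, B ⊆ A → ∀ j, (∀ i ∈ B, g i = j) →
      B.card ≤ a / r + 1 := by
  classical
  set N := a / r + 1 with hN
  have hN0 : 0 < N := Nat.succ_pos _
  have haN : a < N * r := (Nat.div_lt_iff_lt_mul hr).1 (Nat.lt_succ_self _)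
  let idx : α → ℕ := fun i => if h : i ∈ A then (A.equivFin ⟨i, h⟩).val else 0
  have hidx : ∀ i, idx i / N < r := fun i => by
    refine (Nat.div_lt_iff_lt_mul hN0).2 ?_
    rw [mul_comm]
    refine lt_of_le_of_lt ?_ haN
    by_cases h : i ∈ A
    · simp only [idx, h, dif_pos]
      exact (A.equivFin ⟨i, h⟩).isLt.le.trans hA
    · simp [idx, h]
  refine ⟨fun i => ⟨idx i / N, hidx i⟩, fun B hB j hj => ?_⟩
  have h1 : B.card ≤ (Finset.Ico (j.val * N) (j.val * N + N)).card := by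
    refine Finset.card_le_card_of_injOn idx (fun i hi => ?_) (fun i hi i' hi' h => ?_)
    · have h2 : idx i / N = j.val := congrArg Fin.val (hj i hi)
      have h3 := Nat.div_add_mod (idx i) N
      have h4 := Nat.mod_lt (idx i) hN0
      rw [h2, mul_comm] at h3
      simp only [Finset.coe_Ico, Set.mem_Ico]
      omega
    · have hiA := hB hi
      have hiA' := hB hi'
      simp only [idx, hiA, hiA', dif_pos] at h
      simpa using A.equivFin.injective (Fin.ext h)
  simpa using h1

/-- Labels of separated unit vectors are computed by a network whose widths are large in terms of
the auxiliary parameters `X`, `ℓ` and `L`. -/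
theorem exists_network_of_separated (φ₁ φ₂ φ₃ : Activation) {n m d r m' d' K N K₁ : ℕ}
    (hm' : 2 * m' ≤ m) (hd' : 2 * d' ≤ d) (hr : 0 < r) {X ℓ L : ℝ} (hX : 4000 ≤ X) (hℓ : 4 ≤ ℓ)
    (hℓX : ℓ ≤ X) (hm : X ^ 5 / 3 ≤ m') (hKX : (K : ℝ) ≤ Real.exp X) (hℓL : ℓ ≤ L)
    (hdℓ : (d' : ℝ) ≤ Real.exp ℓ) (hKL : (K : ℝ) ≤ Real.exp L) (hN : N = K₁ / r + 1)
    (hND : 21000000 * (N * L ^ 3) ≤ d') (x : Fin K → EuclideanSpace ℝ (Fin n))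
    (y : Fin K → Fin 2) (hx : ∀ k, ‖x k‖ = 1)
    (hsep : ∀ i j, i ≠ j → 20 * Real.log ℓ / Real.log X ≤ ‖x i - x j‖ ^ 2)
    (hK₁ : (Finset.univ.filter (fun k => y k = 1)).card ≤ K₁) :
    ∃ F ∈ NetworkClass φ₁ φ₂ φ₃ n m d r, ∀ k, F (x k) = 0 ↔ y k = 0 := by
  obtain ⟨V, b, μ, T, hμ, hTV, hT, hTT⟩ := exists_first_layer hX hℓ hℓX hm hKX x hx hsep
  obtain ⟨grp, hgrp⟩ := exists_grouping _ hK₁ hr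
  let G : Fin r → Finset (Fin K) := fun j => Finset.univ.filter fun i => y i = 1 ∧ grp i = j
  have hG : ∀ i j, i ∈ G j ↔ y i = 1 ∧ grp i = j := fun i j => by simp [G]
  have hGN : ∀ j, (G j).card ≤ N := fun j => by
    rw [hN]
    refine hgrp (G j) (fun i hi => ?_) j fun i hi => ((hG i j).1 hi).2
    simpa using ((hG i j).1 hi).1
  obtain ⟨W, c, t, S, ht, hSW, hS, hSS⟩ := exists_second_layer hℓ hℓL hdℓ hKL
    (hN ▸ Nat.succ_pos _) hND hμ T (fun k => (hT k).1) (fun k => (hT k).2) hTT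
    (fun k => G (grp k)) fun k => hGN _
  obtain ⟨F, hF, hFx⟩ := exists_network_of_thresholds φ₁ φ₂ φ₃ hm' hd' x V (fun _ => b) W
    (fun _ => c) (Matrix.of fun j => (indVec ((G j).biUnion S)).ofLp) (fun _ => t)
    (fun k => (indVec (T k)).ofLp) (fun k i => by simp [indVec, hTV])
    (fun k => (indVec (S k)).ofLp) (fun k i => by
      change (if i ∈ S k then (1 : ℝ) else 0) = _
      simp only [hSW])
  have hFx' : ∀ k j, F (x k) j = φ₃.eval ((((G j).biUnion S ∩ S k).card : ℝ) - t) := fun k j => by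
    rw [hFx, ← inner_indVec]
    congr 2
    simp [Matrix.mulVec, dotProduct, PiLp.inner_apply, mul_comm]
  refine ⟨F, hF, fun k => ⟨fun h => ?_, fun h => ?_⟩⟩
  · by_contra hy
    have hy1 : y k = 1 := by omega
    have h1 : F (x k) (grp k) = 0 := by rw [h]; rfl
    rw [hFx', Activation.eval_eq_zero_iff, Finset.inter_eq_right.2
      (Finset.subset_biUnion_of_mem S ((hG k _).2 ⟨hy1, rfl⟩))] at h1
    linarith [hS k]
  · ext j
    rw [hFx']
    refine (Activation.eval_eq_zero_iff _ _).2 (sub_nonpos.2 ?_)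
    -- The overlap bound is indexed by points through their groups, so it misses empty groups; for
    -- those `0 ≤ t` suffices.
    rcases (G j).eq_empty_or_nonempty with h0 | ⟨i, hi⟩
    · simpa [h0] using ht
    · have hij := ((hG i j).1 hi).2
      have h1 := hSS i k (fun hk => by
        have := ((hG k _).1 hk).1
        omega)
      rwa [hij] at h1

/-! ### Choice of parameters -/

theorem theorem6p1 :
    ∃ C c : ℝ, 0 < C ∧ 0 < c ∧
      ∀ (φ₁ φ₂ φ₃ : Activation) (n m d r : ℕ),
        0 < n → 0 < m → 0 < d → 0 < r →
      ∀ (K K₁ : ℕ) (x : Fin K → EuclideanSpace ℝ (Fin n)) (y : Fin K → Fin 2),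
        (∀ k, ‖x k‖ = 1) →
        (∀ i j, i ≠ j →
          C * Real.sqrt (Real.log (Real.log (d : ℝ)) / Real.log (m : ℝ)) ≤ ‖x i - x j‖) →
        (Finset.univ.filter (fun k => y k = 1)).card ≤ K₁ →
        (K₁ : ℝ) * Real.log ((d : ℝ) * (K : ℝ)) ^ 5 ≤ c * (d : ℝ) * (r : ℝ) →
        (K : ℝ) ≤ Real.exp (c * (m : ℝ) ^ ((1 : ℝ) / 5)) →
        (K : ℝ) ≤ Real.exp (c * (d : ℝ) ^ ((1 : ℝ) / 5)) →
        (d : ℝ) ≤ Real.exp (c * (m : ℝ) ^ ((1 : ℝ) / 5)) →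
        ∃ F ∈ NetworkClass φ₁ φ₂ φ₃ n m d r, ∀ k, F (x k) = 0 ↔ y k = 0 := by
  refine ⟨10, 1 / 10 ^ 10, by norm_num, by norm_num, ?_⟩
  intro φ₁ φ₂ φ₃ n m d r _ hm hd hr K K₁ x y hx hsep hK₁ hKd hKX hKY _
  rcases le_or_gt K 1 with hK | hK
  · have : Subsingleton (Fin K) := Fin.subsingleton_iff_le_one.2 hK
    rcases isEmpty_or_nonempty (Fin K) with h0 | ⟨⟨k₀⟩⟩
    · obtain ⟨F, hF, -⟩ := exists_constant_network φ₁ φ₂ φ₃ (n := n) (m := m) (d := d) hr 0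
      exact ⟨F, hF, fun k => h0.elim k⟩
    · obtain ⟨F, hF, h⟩ := exists_constant_network φ₁ φ₂ φ₃ (n := n) (m := m) (d := d) hr (y k₀)
      exact ⟨F, hF, fun k => by rw [Subsingleton.elim k k₀]; exact h _⟩
  have root : ∀ a : ℕ, ((a : ℝ) ^ ((1 : ℝ) / 5)) ^ 5 = a := fun a => by
    rw [one_div]; exact Real.rpow_inv_natCast_pow (n := 5) (by positivity) (by norm_num)
  set X := (m : ℝ) ^ ((1 : ℝ) / 5)
  set Y := (d : ℝ) ^ ((1 : ℝ) / 5)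
  have hXm : X ^ 5 = m := root m
  have hYd : Y ^ 5 = d := root d
  have hK2 : (2 : ℝ) ≤ K := by exact_mod_cast hK
  have hKpos : (0 : ℝ) < K := by linarith
  -- Two points already force `log 2 ≤ Z / 10^10`, so all size requirements follow from `K ≥ 2`.
  have large : ∀ Z : ℝ, (K : ℝ) ≤ Real.exp (1 / 10 ^ 10 * Z) → 4 * 10 ^ 9 ≤ Z := fun Z hZ => by
    have h1 := (Real.log_le_iff_le_exp two_pos).2 (hK2.trans hZ)
    linarith [Real.log_two_gt_d9]
  have hX := large X hKX
  have hY := large Y hKY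
  have hX0 : 0 < X := by linarith
  have hY0 : 0 < Y := by linarith
  have hself : ∀ Z : ℝ, 4 * 10 ^ 9 ≤ Z → Z ≤ Z ^ 5 := fun Z hZ =>
    le_self_pow₀ (by linarith) (by norm_num)
  have hm3 : 3 ≤ m := by
    have : (3 : ℝ) ≤ m := by rw [← hXm]; linarith [hself X hX]
    exact_mod_cast this
  have hd100 : (100 : ℝ) ≤ d := by rw [← hYd]; linarith [hself Y hY]
  have hd3 : 3 ≤ d := by
    have : (3 : ℝ) ≤ d := by linarith
    exact_mod_cast this
  have hd0 : (0 : ℝ) < d := by linarith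
  have half : ∀ a : ℕ, 3 ≤ a → (a : ℝ) / 3 ≤ (a / 2 : ℕ) := fun a ha => by
    have h1 : a ≤ 3 * (a / 2) := by omega
    have h2 : (a : ℝ) ≤ 3 * (a / 2 : ℕ) := by exact_mod_cast h1
    linarith
  set ℓ := Real.log d with hℓdef
  have hexpℓ : Real.exp ℓ = d := Real.exp_log hd0
  have hℓ : 4 ≤ ℓ := by
    rw [hℓdef, Real.le_log_iff_exp_le hd0]
    calc Real.exp 4 = Real.exp 1 ^ 4 := by rw [← Real.exp_nat_mul]; norm_num
      _ ≤ 3 ^ 4 := pow_le_pow_left₀ (Real.exp_pos _).le (by linarith [Real.exp_one_lt_d9]) 4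
      _ ≤ d := by linarith
  have hℓY : ℓ = 5 * Real.log Y := by
    rw [hℓdef, ← hYd, Real.log_pow]; norm_num
  have hmX : Real.log m = 5 * Real.log X := by
    rw [← hXm, Real.log_pow]; norm_num
  have hlogX : 0 < Real.log X := Real.log_pos (by linarith)
  have hlogℓ : 0 < Real.log ℓ := Real.log_pos (by linarith)
  -- `C² = 100` and `log m = 5 log X` give the factor `20`.
  have hsep' : ∀ i j, i ≠ j → 20 * Real.log ℓ / Real.log X ≤ ‖x i - x j‖ ^ 2 := fun i j hij => by
    have h1 := pow_le_pow_left₀ (by positivity) (hsep i j hij) 2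
    rw [mul_pow, Real.sq_sqrt (by rw [hmX]; positivity), hmX] at h1
    refine le_trans (le_of_eq ?_) h1
    field_simp
    norm_num
  -- Unit vectors are at distance at most `2`, so the separation itself forces `5 log ℓ ≤ log X`.
  have hℓX : ℓ ≤ X := by
    have h1 := hsep' ⟨0, by omega⟩ ⟨1, hK⟩ (by simp)
    have h2 : ‖x ⟨0, by omega⟩ - x ⟨1, hK⟩‖ ≤ 2 := (norm_sub_le _ _).trans (by
      rw [hx, hx]; norm_num)
    have h3 : 20 * Real.log ℓ / Real.log X ≤ 4 := by
      nlinarith [norm_nonneg (x ⟨0, by omega⟩ - x ⟨1, hK⟩)]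
    rw [div_le_iff₀ hlogX] at h3
    exact (Real.log_le_log_iff (by linarith) hX0).1 (by linarith)
  set L := Real.log (d * K) with hL
  have hLsum : L = ℓ + Real.log K := Real.log_mul hd0.ne' hKpos.ne'
  have hlogK : 0 ≤ Real.log K := Real.log_nonneg (by linarith)
  have hlogKY : Real.log K ≤ 1 / 10 ^ 10 * Y := (Real.log_le_iff_le_exp hKpos).2 hKY
  have hL4 : 4 ≤ L := by linarith
  have hLY : L ≤ 6 * Y := by linarith [Real.log_le_self hY0.le]
  have hr0 : (0 : ℝ) < r := by exact_mod_cast hr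
  have hL3 : 10 ^ 9 * L ^ 3 ≤ d := by
    calc 10 ^ 9 * L ^ 3 ≤ 10 ^ 9 * (6 * Y) ^ 3 := by gcongr
      _ = 216 * 10 ^ 9 * Y ^ 3 := by ring
      _ ≤ (Y * Y) * Y ^ 3 := by
          have : (4 * 10 ^ 9) * (4 * 10 ^ 9) ≤ Y * Y := mul_le_mul hY hY (by norm_num) hY0.le
          exact mul_le_mul_of_nonneg_right (by linarith) (by positivity)
      _ = d := by rw [← hYd]; ring
  have hK₁L : 10 ^ 10 * ((K₁ / r : ℝ) * L ^ 3) ≤ d := by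
    have h1 : L ^ 3 ≤ L ^ 5 := pow_le_pow_right₀ (by linarith) (by norm_num)
    calc 10 ^ 10 * ((K₁ / r : ℝ) * L ^ 3) ≤ 10 ^ 10 * ((K₁ / r : ℝ) * L ^ 5) := by gcongr
      _ = 10 ^ 10 * (K₁ * L ^ 5) / r := by ring
      _ ≤ 10 ^ 10 * (1 / 10 ^ 10 * d * r) / r := by gcongr
      _ = d := by field_simp
  refine exists_network_of_separated φ₁ φ₂ φ₃ (Nat.mul_div_le m 2) (Nat.mul_div_le d 2) hr
    (X := X) (ℓ := ℓ) (L := L) (by linarith) hℓ hℓX (by rw [hXm]; exact half m hm3)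
    (hKX.trans (Real.exp_le_exp.2 (by linarith))) (by linarith)
    (by rw [hexpℓ]; exact_mod_cast Nat.div_le_self d 2)
    ((Real.log_le_iff_le_exp hKpos).1 (by linarith)) rfl ?_ x y hx hsep' hK₁
  have h1 : ((K₁ / r + 1 : ℕ) : ℝ) ≤ K₁ / r + 1 := by
    push_cast
    linarith [Nat.cast_div_le (α := ℝ) (m := K₁) (n := r)]
  have h2 : ((K₁ / r + 1 : ℕ) : ℝ) * L ^ 3 ≤ (K₁ / r + 1) * L ^ 3 :=
    mul_le_mul_of_nonneg_right h1 (by positivity)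
  have h3 := half d hd3
  linarith
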